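/- Let $\log$ denote the logarithm to base $2$. The density of a finite graph with $n$ vertices and $m$ edges is $m/\binom n2$, or $1$ if $n=1$. For a finite graph $G=(V,E)$ and $0<\rho\le 1$, a $\rho$-dense clique aggregator of $G$ is a finite collection $S$ of nonempty subsets of $V$ (clusters) such that every nonempty clique of $G$ is contained in some cluster of $S$ and, for every cluster $C\in S$, the induced subgraph $G[C]$ has density at least $\rho$; its size is the number of clusters $|S|$. For large $n$ put $k=k(n)=\left\lceil \tfrac12\,\frac{\log n}{\log\log n}\right\rceil$, and let $\mathbb G_n$ be the random $k$-partite graph on the vertex set $\{0,\dots,n-1\}$ whose parts are the residue classes modulo $k$ (so that part sizes differ by at most one, and all equal $n/k$ when $k\mid n$), in which each pair of vertices from two different parts is joined by an edge independently with probability $1/\log n$. **Theorem.** There exist a constant $c>0$, a function $g:\mathbb N\to\mathbb R$ with $g(n)=o(n)$, and a family $\mathcal G=(\mathcal G_n)_{n\in\mathbb N}$, where each $\mathcal G_n$ is a set of $k(n)$-partite graphs on $\{0,\dots,n-1\}$ with the above parts, such that $\Pr[\mathbb G_n\in\mathcal G_n]\to 1$ as $n\to\infty$ and, for every $n$, every $G\in\mathcal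 G_n$, every $\rho\in(0,1]$ with $\rho\ge c/\log n$, and every $\rho$-dense clique aggregator $S$ of $G$, $$ n^{\frac{3\log n}{8\log\log n}}\;\le\; g(n)\cdot|S| .$$ That is, every $\rho$-dense clique aggregator of every graph of the family has size $\Omega^*\!\left(n^{\frac{3\log n}{8\log\log n}}\right)$, where $\Omega^*$ hides factors sublinear in $n$. (For the finitely many small $n$ for which these expressions are undefined or the probability is not in $[0,1]$, any conventions may be used; $\mathcal G_n$ may be empty for them.) -/

import Mathlib

open Filter Topology Asymptotics MeasureTheory

noncomputable section

/-- The density `m / (n choose 2)` of a finite graph with `n` vertices and `m` edges; a graph with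
a single vertex has density `1`. -/
def graphDensity {V : Type*} (G : SimpleGraph V) : ℝ :=
  if Nat.card V = 1 then 1 else (G.edgeSet.ncard : ℝ) / ((Nat.card V).choose 2 : ℝ)

/-- A `ρ`-dense aggregator of `G`: a collection `S` of clusters (nonempty sets of vertices), each
inducing a subgraph of density at least `ρ`, such that every (nonempty) clique of `G` is contained
in some member of `S`. -/
structure IsDenseAggregator {V : Type*} (G : SimpleGraph V) (ρ : ℝ)
    (S : Finset (Finset V)) : Prop where
  nonempty_of_mem : ∀ C ∈ S, C.Nonempty
  clique_subset : ∀ H : Finset V, H.Nonempty → G.IsClique (H : Set V) → ∃ C ∈ S, H ⊆ C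
  density_ge : ∀ C ∈ S, ρ ≤ graphDensity (G.induce (C : Set V))

/-- The law of the random subgraph of `H` that keeps each edge of `H` independently with
probability `p` (and has no other edges). -/
def randomSubgraph {V : Type*} (H : SimpleGraph V) (p : unitInterval) :
    Measure (SimpleGraph V) :=
  (ProbabilityTheory.setBernoulli H.edgeSet p).map SimpleGraph.fromEdgeSet

/-- The number of parts, `(1/2) log n / log log n` (logarithms to base `2`), rounded up to an
integer. -/
def numParts (n : ℕ) : ℕ :=
  ⌈Real.logb 2 n / (2 * Real.logb 2 (Real.logb 2 n))⌉₊

/-- The edge probability `1 / log n`, which lies in `[0, 1]` whenever `2 ≤ n`. -/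
def edgeProb (n : ℕ) : unitInterval :=
  Set.projIcc (0 : ℝ) 1 zero_le_one (1 / Real.logb 2 n)

/-- The law of the random `k`-partite graph on `n` vertices, `k = numParts n`: the vertices
`0, …, n - 1` are split into the residue classes modulo `k` (whose sizes differ by at most one, and
all equal `n / k` when `k ∣ n`), and each pair of vertices from different classes is joined
independently with probability `1 / log n`. -/
def randomPartite (n : ℕ) : Measure (SimpleGraph (Fin n)) :=
  randomSubgraph (SimpleGraph.turanGraph n (numParts n)) (edgeProb n)

end

/-! Write L = log n, l = log log n, p = 1/L, m = ⌊n/k⌋. A clique with one vertex in each of the k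
parts is called transversal. With high probability there are very many of them, while a dense
cluster is small and holds few, so many clusters are needed. Many: the expected number is m^k p^(k
choose 2). Two transversals agreeing in j parts are positively correlated by a factor at most
(p^(-k))^j, and p^(-k) = L^k is about n^(1/2) since k is about L/(2l). This is far below m, so
Chebyshev gives at least half the expectation (`randomSubgraph_real_numTransversalCliques_lt_le`).
Few: a union bound over vertex sets shows that no set of more than 2L² vertices has density 6/L or
more (`real_exists_large_dense_le`). Hence a cluster contains at most (2L²)^k / k! transversal
cliques (`numTransversalCliques_le`). Quotient: the k! offsets the k^k lost in m^k up to a factor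
8^k, and Lk - lk²/2 at k = L/(2l) equals 3L²/(8l), the target exponent. The remaining factors cost
n^(3/4 + o(1)), which g(n) = n^(9/10) absorbs (`rpow_mul_le`). -/

open scoped unitInterval

/-! ### Edge-containment probabilities in a random subgraph. -/

section RandomSubgraph

variable {V : Type*}

theorem SimpleGraph.discreteMeasurableSpace [Finite V] :
    DiscreteMeasurableSpace (SimpleGraph V) where
  forall_measurableSet S := by
    have h : S = SimpleGraph.edgeSet ⁻¹' (SimpleGraph.edgeSet '' S) :=
      (Set.preimage_image_eq S SimpleGraph.edgeSet_injective).symm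
    rw [h]
    exact SimpleGraph.measurableEmbedding_edgeSet.measurable (Set.toFinite _).measurableSet

theorem setBernoulli_real_superset {ι : Type*} [Finite ι] (u : Set ι) (p : I) (F : Finset ι)
    (hF : (F : Set ι) ⊆ u) :
    (ProbabilityTheory.setBernoulli u p).real {s | (F : Set ι) ⊆ s} = (p : ℝ) ^ F.card := by
  rw [measureReal_def, ProbabilityTheory.setBernoulli_apply']
  have h : ((fun q : ι → Prop => {i | q i}) ⁻¹' {s | (F : Set ι) ⊆ s}) =
      (F : Set ι).pi fun _ => {True} := by
    ext q
    simp [Set.pi, Set.subset_def]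
  rw [h, Measure.infinitePi_pi _ (fun i _ => MeasurableSet.of_discrete)]
  rw [Finset.prod_congr rfl (g := fun _ => ((unitInterval.toNNReal p : NNReal) : ENNReal))]
  · simp
  · intro i hi
    simp [hF hi]

instance randomSubgraph_isProbabilityMeasure [Finite V] (H : SimpleGraph V) (p : I) :
    IsProbabilityMeasure (randomSubgraph H p) :=
  Measure.isProbabilityMeasure_map (SimpleGraph.measurable_fromEdgeSet).aemeasurable

theorem randomSubgraph_apply [Finite V] (H : SimpleGraph V) (p : I) (S : Set (SimpleGraph V)) :
    randomSubgraph H p S =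
      ProbabilityTheory.setBernoulli H.edgeSet p (SimpleGraph.fromEdgeSet ⁻¹' S) :=
  have := SimpleGraph.discreteMeasurableSpace (V := V)
  Measure.map_apply SimpleGraph.measurable_fromEdgeSet (MeasurableSet.of_discrete)

theorem randomSubgraph_not_le [Finite V] (H : SimpleGraph V) (p : I) :
    randomSubgraph H p {G | ¬ G ≤ H} = 0 := by
  rw [randomSubgraph_apply]
  refine measure_mono_null ?_ (ProbabilityTheory.setBernoulli_ae_subset (u := H.edgeSet) (p := p))
  intro s hs hsH
  refine hs ?_
  rw [← SimpleGraph.edgeSet_subset_edgeSet, SimpleGraph.edgeSet_fromEdgeSet]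
  exact fun e he => hsH he.1

theorem randomSubgraph_real_superset [Finite V] (H : SimpleGraph V) (p : I)
    (F : Finset (Sym2 V)) (hF : (F : Set (Sym2 V)) ⊆ H.edgeSet) :
    (randomSubgraph H p).real {G | (F : Set (Sym2 V)) ⊆ G.edgeSet} = (p : ℝ) ^ F.card := by
  rw [← setBernoulli_real_superset H.edgeSet p F hF, measureReal_def, randomSubgraph_apply,
    measureReal_def]
  congr 2
  ext s
  simp only [Set.mem_preimage, Set.mem_ofPred_eq, SimpleGraph.edgeSet_fromEdgeSet]
  refine ⟨fun h e he => (h he).1, fun h e he => ⟨h he, ?_⟩⟩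
  -- `fromEdgeSet` discards loops, and `F` has none because it lies in `H.edgeSet`.
  exact H.not_isDiag_of_mem_edgeSet (hF he)

/-- If `F` leaves the edge set of `H`, the event is null; this lets union bounds run over all pairs
in a vertex set. -/
theorem randomSubgraph_real_superset_le [Finite V] (H : SimpleGraph V) (p : I)
    (F : Finset (Sym2 V)) :
    (randomSubgraph H p).real {G | (F : Set (Sym2 V)) ⊆ G.edgeSet} ≤ (p : ℝ) ^ F.card := by
  by_cases hF : (F : Set (Sym2 V)) ⊆ H.edgeSet
  · exact (randomSubgraph_real_superset H p F hF).le
  · refine le_trans (le_of_eq ?_) (pow_nonneg p.2.1 _)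
    rw [measureReal_def, measure_mono_null _ (randomSubgraph_not_le H p), ENNReal.toReal_zero]
    intro G hG hGH
    exact hF (hG.trans (SimpleGraph.edgeSet_subset_edgeSet.2 hGH))

end RandomSubgraph

/-! ### Vertex pairs, cliques and induced edges. -/

section Pairs

variable {V : Type*} [DecidableEq V]

/-- The unordered pairs of distinct elements of a finite set. -/
def pairsOn (A : Finset V) : Finset (Sym2 V) := A.sym2.filter fun e => ¬ e.IsDiag

theorem mem_pairsOn {A : Finset V} {e : Sym2 V} :
    e ∈ pairsOn A ↔ (∀ v ∈ e, v ∈ A) ∧ ¬ e.IsDiag := by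
  rw [pairsOn, Finset.mem_filter, Finset.mem_sym2_iff]

theorem mk_mem_pairsOn {A : Finset V} {v w : V} :
    s(v, w) ∈ pairsOn A ↔ v ∈ A ∧ w ∈ A ∧ v ≠ w := by
  simp [mem_pairsOn, and_assoc]

theorem card_pairsOn (A : Finset V) : (pairsOn A).card = A.card.choose 2 := by
  rw [← Sym2.card_image_offDiag]
  congr 1
  ext e
  induction e with | _ v w
  rw [mk_mem_pairsOn]
  simp only [Finset.mem_image, Finset.mem_offDiag, Prod.exists, Function.uncurry_apply_pair,
    Sym2.eq_iff]
  grind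

theorem pairsOn_inter (A B : Finset V) : pairsOn A ∩ pairsOn B = pairsOn (A ∩ B) := by
  ext e
  simp only [Finset.mem_inter, mem_pairsOn]
  grind

theorem pairsOn_subset_edgeSet_iff {G : SimpleGraph V} {A : Finset V} :
    (pairsOn A : Set (Sym2 V)) ⊆ G.edgeSet ↔ G.IsClique (A : Set V) := by
  constructor
  · intro h v hv w hw hvw
    exact h (Finset.mem_coe.2 (mk_mem_pairsOn.2 ⟨hv, hw, hvw⟩))
  · intro h e he
    induction e with | _ v w
    obtain ⟨hv, hw, hvw⟩ := mk_mem_pairsOn.1 (Finset.mem_coe.1 he)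
    exact h hv hw hvw

theorem exists_finset_card_eq_ncard_induce [Finite V] (G : SimpleGraph V) (C : Finset V) :
    ∃ F ⊆ pairsOn C, F.card = (G.induce (C : Set V)).edgeSet.ncard ∧
      (F : Set (Sym2 V)) ⊆ G.edgeSet := by
  have hfin : (Sym2.map Subtype.val '' (G.induce (C : Set V)).edgeSet : Set (Sym2 V)).Finite :=
    Set.toFinite _
  refine ⟨hfin.toFinset, ?_, ?_, ?_⟩
  · intro e he
    obtain ⟨e', he', rfl⟩ := hfin.mem_toFinset.1 he
    induction e' with | _ v w
    have h : G.Adj v w := he'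
    rw [Sym2.map_mk, mk_mem_pairsOn]
    exact ⟨v.2, w.2, h.ne⟩
  · rw [← Set.ncard_eq_toFinset_card,
      Set.ncard_image_of_injective _ (Sym2.map.injective Subtype.val_injective)]
  · rw [hfin.coe_toFinset]
    rintro _ ⟨e, he, rfl⟩
    induction e with | _ v w
    exact he

end Pairs

/-! ### First moment: a fixed vertex set is rarely dense. -/

section DenseSets

variable {V : Type*}

/-- Combine N choose t ≤ N^t/t! with t^t/t! ≤ e^t. The constant 6, which becomes the final `c`, is
chosen so that e/6 < 1/2. -/
theorem choose_mul_pow_le_two_inv_pow {N t : ℕ} {p : ℝ} (hp : 0 ≤ p) (ht : 6 * p * N ≤ t) :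
    (N.choose t : ℝ) * p ^ t ≤ (1 / 2 : ℝ) ^ t := by
  have h1 : (N.choose t : ℝ) ≤ (N : ℝ) ^ t / t.factorial := Nat.choose_le_pow_div t N
  have hf : (0 : ℝ) < t.factorial := by positivity
  have h2 : ((t : ℝ)) ^ t / t.factorial ≤ Real.exp t :=
    Real.pow_div_factorial_le_exp _ (Nat.cast_nonneg t) t
  calc (N.choose t : ℝ) * p ^ t ≤ (N : ℝ) ^ t / t.factorial * p ^ t := by gcongr
    _ = (p * N) ^ t / t.factorial := by rw [mul_pow]; ring
    _ ≤ ((t : ℝ) / 6) ^ t / t.factorial := by gcongr; linarith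
    _ = (t : ℝ) ^ t / t.factorial * (1 / 6) ^ t := by rw [div_pow, one_div, inv_pow]; ring
    _ ≤ Real.exp t * (1 / 6) ^ t := by gcongr
    _ = (Real.exp 1 / 6) ^ t := by
        rw [div_pow (Real.exp 1), ← Real.exp_nat_mul, one_div, inv_pow, mul_one, div_eq_mul_inv]
    _ ≤ (1 / 2 : ℝ) ^ t := by
        exact pow_le_pow_left₀ (by positivity) (by linarith [Real.exp_one_lt_d9]) t

theorem randomSubgraph_real_dense_le [Finite V] (H : SimpleGraph V) (p : I) (C : Finset V)
    (hC : 2 ≤ C.card) {ρ x : ℝ} (hρ : 6 * (p : ℝ) ≤ ρ) (hx : x ≤ ρ * (C.card.choose 2 : ℕ)) :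
    (randomSubgraph H p).real {G | ρ ≤ graphDensity (G.induce (C : Set V))} ≤
      (1 / 2 : ℝ) ^ x := by
  classical
  have hchoose : 0 < C.card.choose 2 := Nat.choose_pos hC
  set N := C.card.choose 2 with hN
  set t := ⌈ρ * N⌉₊ with ht
  -- A dense `C` contains some set of exactly `t` present edges; the union bound runs over these
  -- sets.
  have hsub : {G : SimpleGraph V | ρ ≤ graphDensity (G.induce (C : Set V))} ⊆
      ⋃ F ∈ (pairsOn C).powersetCard t, {G | (F : Set (Sym2 V)) ⊆ G.edgeSet} := by
    intro G hG
    have hcard : Nat.card (C : Set V) = C.card := by simp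
    rw [Set.mem_ofPred_eq, graphDensity, if_neg (by omega), hcard, le_div_iff₀ (by positivity)] at hG
    have hle : t ≤ (G.induce (C : Set V)).edgeSet.ncard := Nat.ceil_le.2 hG
    obtain ⟨F, hFC, hF, hFG⟩ := exists_finset_card_eq_ncard_induce G C
    obtain ⟨F', hF'F, hF'⟩ := Finset.exists_subset_card_eq (hle.trans_eq hF.symm)
    simp only [Set.mem_iUnion]
    refine ⟨F', Finset.mem_powersetCard.2 ⟨hF'F.trans hFC, hF'⟩, ?_⟩
    exact (Finset.coe_subset.2 hF'F).trans hFG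
  have hp : (0 : ℝ) ≤ p := p.2.1
  calc _ ≤ (randomSubgraph H p).real
        (⋃ F ∈ (pairsOn C).powersetCard t, {G | (F : Set (Sym2 V)) ⊆ G.edgeSet}) :=
        measureReal_mono hsub (measure_ne_top _ _)
    _ ≤ ∑ F ∈ (pairsOn C).powersetCard t,
        (randomSubgraph H p).real {G | (F : Set (Sym2 V)) ⊆ G.edgeSet} :=
        measureReal_biUnion_finset_le _ _
    _ ≤ ∑ F ∈ (pairsOn C).powersetCard t, (p : ℝ) ^ t := by
        refine Finset.sum_le_sum fun F hF => ?_
        rw [← (Finset.mem_powersetCard.1 hF).2]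
        exact randomSubgraph_real_superset_le H p F
    _ = (N.choose t : ℝ) * (p : ℝ) ^ t := by
        rw [Finset.sum_const, Finset.card_powersetCard, card_pairsOn, nsmul_eq_mul]
    _ ≤ (1 / 2 : ℝ) ^ t := by
        refine choose_mul_pow_le_two_inv_pow hp (le_trans ?_ (Nat.le_ceil _))
        gcongr
    _ ≤ (1 / 2 : ℝ) ^ x := by
        rw [← Real.rpow_natCast]
        exact Real.rpow_le_rpow_of_exponent_ge (by norm_num) (by norm_num)
          (hx.trans (Nat.le_ceil _))

end DenseSets

/-- Second moment method: if the pair probabilities of a finite family of events sum to at most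
`(1 + ε) M ^ 2`, where `M` is the expected number of events that occur, then it is unlikely that
fewer than `M / 2` of them occur. -/
theorem measureReal_card_lt_half_le {Ω ι : Type*} [MeasurableSpace Ω] [DiscreteMeasurableSpace Ω]
    [Fintype ι] (μ : Measure Ω) [IsProbabilityMeasure μ] (A : ι → Set Ω) {M ε : ℝ} (hM : 0 < M)
    (h1 : ∑ i, μ.real (A i) = M) (h2 : ∑ i, ∑ j, μ.real (A i ∩ A j) ≤ (1 + ε) * M ^ 2) :
    μ.real {ω | ({i | ω ∈ A i}.ncard : ℝ) < M / 2} ≤ 4 * ε := by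
  classical
  set X : Ω → ℝ := fun ω => ∑ i, (A i).indicator (fun _ => (1 : ℝ)) ω with hX
  have hXcard : ∀ ω, X ω = ({i | ω ∈ A i}.ncard : ℝ) := by
    intro ω
    simp [hX, Set.indicator_apply, Set.ncard_eq_toFinset_card']
  have hLp : ∀ i, MemLp ((A i).indicator (fun _ => (1 : ℝ))) 2 μ := fun i =>
    memLp_indicator_const _ (MeasurableSet.of_discrete) _ (Or.inr (measure_ne_top _ _))
  have hXLp : MemLp X 2 μ := memLp_finsetSum _ fun i _ => hLp i
  have hmean : ∫ ω, X ω ∂μ = M := by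
    rw [← h1, integral_finsetSum _ fun i _ => (hLp i).integrable (by norm_num)]
    exact Finset.sum_congr rfl fun i _ => by
      rw [integral_indicator_const _ (MeasurableSet.of_discrete)]; simp
  have hsq : ∫ ω, (X ^ 2) ω ∂μ = ∑ i, ∑ j, μ.real (A i ∩ A j) := by
    have hpt : ∀ ω, (X ^ 2) ω = ∑ i, ∑ j, (A i ∩ A j).indicator (fun _ => (1 : ℝ)) ω := by
      intro ω
      rw [Pi.pow_apply, sq, hX, Finset.sum_mul_sum]
      refine Finset.sum_congr rfl fun i _ => Finset.sum_congr rfl fun j _ => ?_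
      by_cases hi : ω ∈ A i <;> by_cases hj : ω ∈ A j <;> simp [hi, hj]
    have hint : ∀ i j, Integrable ((A i ∩ A j).indicator (fun _ => (1 : ℝ))) μ := fun i j =>
      (integrable_const _).indicator MeasurableSet.of_discrete
    simp_rw [hpt]
    rw [integral_finsetSum _ fun i _ => integrable_finsetSum _ fun j _ => hint i j]
    refine Finset.sum_congr rfl fun i _ => ?_
    rw [integral_finsetSum _ fun j _ => hint i j]
    exact Finset.sum_congr rfl fun j _ => by
      rw [integral_indicator_const _ (MeasurableSet.of_discrete)]; simp
  have hvar : ProbabilityTheory.variance X μ ≤ ε * M ^ 2 := by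
    rw [ProbabilityTheory.variance_eq_sub hXLp, hmean, hsq]
    linarith
  have hcheb := ProbabilityTheory.meas_ge_le_variance_div_sq hXLp (half_pos hM)
  rw [hmean] at hcheb
  -- The sign of `ε` is not assumed: it is forced by the variance being nonnegative.
  have hε : 0 ≤ ε := by
    have := (ProbabilityTheory.variance_nonneg X μ).trans hvar
    exact nonneg_of_mul_nonneg_left this (by positivity)
  refine ENNReal.toReal_le_of_le_ofReal (by positivity) ?_
  calc μ {ω | ({i | ω ∈ A i}.ncard : ℝ) < M / 2} ≤ μ {ω | M / 2 ≤ |X ω - M|} := by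
        refine measure_mono fun ω hω => ?_
        rw [Set.mem_ofPred_eq, ← hXcard] at hω
        rw [Set.mem_ofPred_eq, abs_sub_comm]
        exact le_trans (by linarith) (le_abs_self _)
    _ ≤ _ := hcheb
    _ ≤ ENNReal.ofReal (4 * ε) := by
        refine ENNReal.ofReal_le_ofReal ?_
        rw [div_le_iff₀ (by positivity)]
        linarith

/-! ### Transversal cliques: second moment, and how many fit into clusters. -/

section Transversals

variable {n k m : ℕ}

/-- The vertex `i + k a` of the residue class of `i` modulo `k`. -/
def classVertex (h : k * m ≤ n) (i : Fin k) (a : Fin m) : Fin n :=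
  ⟨i + k * a, by
    have h1 : k * (a + 1) ≤ k * m := Nat.mul_le_mul_left k a.2
    have h2 := i.2
    rw [Nat.mul_add, Nat.mul_one] at h1
    omega⟩

/-- The set of vertices picked by a choice function, one in each residue class modulo `k`. -/
def transversal (h : k * m ≤ n) (f : Fin k → Fin m) : Finset (Fin n) :=
  Finset.univ.image fun i => classVertex h i (f i)

theorem classVertex_mod (h : k * m ≤ n) (i : Fin k) (a : Fin m) :
    (classVertex h i a : ℕ) % k = i := by
  simp [classVertex, Nat.mod_eq_of_lt i.2]

theorem classVertex_inj (h : k * m ≤ n) {i j : Fin k} {a b : Fin m} :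
    classVertex h i a = classVertex h j b ↔ i = j ∧ a = b := by
  refine ⟨fun hab => ?_, fun hab => by rw [hab.1, hab.2]⟩
  have hij : i = j := Fin.ext (by rw [← classVertex_mod h i a, hab, classVertex_mod])
  subst hij
  refine ⟨rfl, Fin.ext ?_⟩
  have hv := congrArg Fin.val hab
  simp only [classVertex] at hv
  exact Nat.eq_of_mul_eq_mul_left (by have := i.2; omega) (Nat.add_left_cancel hv)

theorem card_transversal (h : k * m ≤ n) (f : Fin k → Fin m) : (transversal h f).card = k := by
  rw [transversal, Finset.card_image_of_injective, Finset.card_univ, Fintype.card_fin]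
  exact fun i j hij => ((classVertex_inj h).1 hij).1

theorem card_transversal_inter (h : k * m ≤ n) (f g : Fin k → Fin m) :
    (transversal h f ∩ transversal h g).card = (Finset.univ.filter fun i => f i = g i).card := by
  have hinter : transversal h f ∩ transversal h g =
      (Finset.univ.filter fun i => f i = g i).image fun i => classVertex h i (f i) := by
    ext v
    simp only [transversal, Finset.mem_inter, Finset.mem_image, Finset.mem_univ, true_and,
      Finset.mem_filter]
    constructor
    · rintro ⟨⟨i, rfl⟩, j, hj⟩
      obtain ⟨rfl, hfg⟩ := (classVertex_inj h).1 hj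
      exact ⟨j, hfg.symm, rfl⟩
    · rintro ⟨i, hi, rfl⟩
      exact ⟨⟨i, rfl⟩, i, by rw [hi]⟩
  rw [hinter, Finset.card_image_of_injective]
  exact fun i j hij => ((classVertex_inj h).1 hij).1

theorem transversal_injective (h : k * m ≤ n) :
    Function.Injective (transversal h : (Fin k → Fin m) → Finset (Fin n)) := by
  intro f g hfg
  have hc := card_transversal_inter h f g
  rw [hfg, Finset.inter_self, card_transversal] at hc
  have huniv : (Finset.univ.filter fun i => f i = g i) = Finset.univ :=
    Finset.eq_univ_of_card _ (by rw [← hc, Fintype.card_fin])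
  funext i
  have hi : i ∈ Finset.univ.filter fun i => f i = g i := by rw [huniv]; exact Finset.mem_univ i
  exact (Finset.mem_filter.1 hi).2

theorem isClique_transversal (h : k * m ≤ n) (f : Fin k → Fin m) :
    (SimpleGraph.turanGraph n k).IsClique (transversal h f : Set (Fin n)) := by
  intro v hv w hw hvw
  simp only [transversal, Finset.coe_image, Finset.coe_univ, Set.image_univ, Set.mem_range]
    at hv hw
  obtain ⟨i, rfl⟩ := hv
  obtain ⟨j, rfl⟩ := hw
  rw [SimpleGraph.turanGraph_adj, classVertex_mod, classVertex_mod]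
  intro hij
  exact hvw (by rw [Fin.ext hij])

/-- The number of transversal cliques of a graph. -/
noncomputable def numTransversalCliques (h : k * m ≤ n) (G : SimpleGraph (Fin n)) : ℕ :=
  {f : Fin k → Fin m | G.IsClique (transversal h f : Set (Fin n))}.ncard

/-- The sum factors over coordinates: in each, one value agrees with `f` and contributes q, the
other m - 1 contribute 1. -/
theorem sum_pow_card_agree (f : Fin k → Fin m) (q : ℝ) :
    ∑ g : Fin k → Fin m, q ^ (Finset.univ.filter fun i => f i = g i).card = (q + m - 1) ^ k := by
  have h1 : ∀ g : Fin k → Fin m, q ^ (Finset.univ.filter fun i => f i = g i).card =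
      ∏ i, if f i = g i then q else 1 := by
    intro g
    rw [Finset.prod_ite]
    simp
  have h2 : ∀ i, (∑ a : Fin m, if f i = a then q else 1) = q + m - 1 := by
    intro i
    have hsplit : ∀ a : Fin m, (if f i = a then q else 1) = (if f i = a then q - 1 else 0) + 1 := by
      intro a; split_ifs <;> ring
    simp_rw [hsplit]
    rw [Finset.sum_add_distrib]
    simp
    ring
  simp_rw [h1]
  rw [← Fintype.prod_sum (fun i a => if f i = a then q else (1 : ℝ))]
  simp_rw [h2]
  simp

/-- The cliques share (j choose 2) pairs, where j is the number of agreements. The crude bound (j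
choose 2) ≤ kj makes the correlation factor geometric in j, as `sum_pow_card_agree` requires. -/
theorem pow_card_pairsOn_union_le (h : k * m ≤ n) (f g : Fin k → Fin m) {p : ℝ} (hp0 : 0 < p)
    (hp1 : p ≤ 1) :
    p ^ (pairsOn (transversal h f) ∪ pairsOn (transversal h g)).card ≤
      (p ^ k.choose 2) ^ 2 * ((1 / p) ^ k) ^ (Finset.univ.filter fun i => f i = g i).card := by
  set j := (Finset.univ.filter fun i => f i = g i).card with hj
  have hjk : j ≤ k := (Finset.card_le_univ _).trans_eq (Fintype.card_fin k)
  have hcard := Finset.card_union_add_card_inter (pairsOn (transversal h f))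
    (pairsOn (transversal h g))
  rw [pairsOn_inter, card_pairsOn, card_pairsOn, card_pairsOn, card_transversal,
    card_transversal, card_transversal_inter, ← hj] at hcard
  have hchoose : j.choose 2 ≤ k * j := by
    rw [Nat.choose_two_right]
    refine (Nat.div_le_self _ _).trans ?_
    rw [mul_comm]
    exact Nat.mul_le_mul_right _ ((Nat.sub_le _ _).trans hjk)
  rw [← pow_mul, ← pow_mul, one_div, inv_pow, ← div_eq_mul_inv, le_div_iff₀ (by positivity),
    ← pow_add]
  exact pow_le_pow_of_le_one hp0.le hp1 (by omega)

theorem randomSubgraph_real_numTransversalCliques_lt_le (h : k * m ≤ n) (hm : 0 < m) (p : I)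
    (hp : 0 < (p : ℝ)) :
    (randomSubgraph (SimpleGraph.turanGraph n k) p).real
      {G | (numTransversalCliques h G : ℝ) < (m : ℝ) ^ k * (p : ℝ) ^ k.choose 2 / 2} ≤
      4 * (Real.exp (k * (1 / (p : ℝ)) ^ k / m) - 1) := by
  have := SimpleGraph.discreteMeasurableSpace (V := Fin n)
  set μ := randomSubgraph (SimpleGraph.turanGraph n k) p
  set A : (Fin k → Fin m) → Set (SimpleGraph (Fin n)) := fun f =>
    {G | (pairsOn (transversal h f) : Set (Sym2 (Fin n))) ⊆ G.edgeSet} with hA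
  have hsub : ∀ f, (pairsOn (transversal h f) : Set (Sym2 (Fin n))) ⊆
      (SimpleGraph.turanGraph n k).edgeSet := fun f =>
    pairsOn_subset_edgeSet_iff.2 (isClique_transversal h f)
  have hcount : ∀ G : SimpleGraph (Fin n), numTransversalCliques h G = {f | G ∈ A f}.ncard := by
    intro G
    simp only [hA, Set.mem_ofPred_eq, pairsOn_subset_edgeSet_iff]
    rfl
  have hm' : (0 : ℝ) < m := Nat.cast_pos.2 hm
  simp_rw [hcount]
  refine measureReal_card_lt_half_le μ A (by positivity) ?_ ?_
  · have hone : ∀ f, μ.real (A f) = (p : ℝ) ^ k.choose 2 := by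
      intro f
      rw [randomSubgraph_real_superset _ _ _ (hsub f), card_pairsOn, card_transversal]
    simp [hone]
  · have htwo : ∀ f g, μ.real (A f ∩ A g) ≤ ((p : ℝ) ^ k.choose 2) ^ 2 *
        ((1 / (p : ℝ)) ^ k) ^ (Finset.univ.filter fun i => f i = g i).card := by
      intro f g
      have hinter : A f ∩ A g = {G | ((pairsOn (transversal h f) ∪ pairsOn (transversal h g) :
          Finset (Sym2 (Fin n))) : Set (Sym2 (Fin n))) ⊆ G.edgeSet} := by
        ext G
        simp [hA]
      rw [hinter]
      exact (randomSubgraph_real_superset_le _ _ _).trans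
        (pow_card_pairsOn_union_le h f g hp p.2.2)
    calc ∑ f, ∑ g, μ.real (A f ∩ A g)
        ≤ ∑ f : Fin k → Fin m, ∑ g : Fin k → Fin m, ((p : ℝ) ^ k.choose 2) ^ 2 *
          ((1 / (p : ℝ)) ^ k) ^ (Finset.univ.filter fun i => f i = g i).card :=
          Finset.sum_le_sum fun f _ => Finset.sum_le_sum fun g _ => htwo f g
      _ = (m : ℝ) ^ k * (((p : ℝ) ^ k.choose 2) ^ 2 * ((1 / (p : ℝ)) ^ k + m - 1) ^ k) := by
          simp_rw [← Finset.mul_sum, sum_pow_card_agree]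
          simp
          ring
      -- With q = (1/p)^k, q + m - 1 ≤ m(1 + q/m) ≤ m exp(q/m).
      _ ≤ (m : ℝ) ^ k * (((p : ℝ) ^ k.choose 2) ^ 2 *
          (m * Real.exp ((1 / (p : ℝ)) ^ k / m)) ^ k) := by
          have hm1 : (1 : ℝ) ≤ m := Nat.one_le_cast.2 hm
          have hq : 0 < (1 / (p : ℝ)) ^ k := by positivity
          gcongr
          · linarith
          · have hexp := Real.add_one_le_exp ((1 / (p : ℝ)) ^ k / m)
            have := mul_le_mul_of_nonneg_left hexp hm'.le
            rw [mul_add, mul_div_cancel₀ _ hm'.ne'] at this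
            linarith
      _ = _ := by
          rw [mul_pow (m : ℝ), ← Real.exp_nat_mul, mul_div_assoc]
          ring

theorem numTransversalCliques_le (h : k * m ≤ n) (hk : 0 < k) {G : SimpleGraph (Fin n)} {ρ : ℝ}
    {S : Finset (Finset (Fin n))} (hS : IsDenseAggregator G ρ S) {s : ℝ}
    (hs : ∀ C ∈ S, (C.card : ℝ) ≤ s) :
    (numTransversalCliques h G : ℝ) ≤ S.card * (s ^ k / k.factorial) := by
  classical
  have hle : numTransversalCliques h G ≤ (S.biUnion fun C => C.powersetCard k).card := by
    rw [numTransversalCliques, ← Set.ncard_coe_finset]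
    refine Set.ncard_le_ncard_of_injOn (transversal h) ?_ (transversal_injective h).injOn
      (Finset.finite_toSet _)
    intro f hf
    have hne : (transversal h f).Nonempty := by
      rw [← Finset.card_pos, card_transversal]; exact hk
    obtain ⟨C, hC, hfC⟩ := hS.clique_subset _ hne hf
    exact Finset.mem_coe.2 (Finset.mem_biUnion.2
      ⟨C, hC, Finset.mem_powersetCard.2 ⟨hfC, card_transversal h f⟩⟩)
  calc (numTransversalCliques h G : ℝ) ≤ ((S.biUnion fun C => C.powersetCard k).card : ℝ) :=
        Nat.cast_le.2 hle
    _ ≤ ((∑ C ∈ S, (C.powersetCard k).card : ℕ) : ℝ) := Nat.cast_le.2 Finset.card_biUnion_le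
    _ ≤ ∑ _C ∈ S, s ^ k / k.factorial := by
        rw [Nat.cast_sum]
        refine Finset.sum_le_sum fun C hC => ?_
        rw [Finset.card_powersetCard]
        refine (Nat.choose_le_pow_div k _).trans ?_
        have := hs C hC
        gcongr
    _ = _ := by rw [Finset.sum_const, nsmul_eq_mul]

end Transversals

/-! ### Estimates for large n. -/

section Asymptotics

theorem tendsto_logb_two_atTop : Tendsto (fun n : ℕ => Real.logb 2 n) atTop atTop :=
  (Real.tendsto_logb_atTop one_lt_two).comp tendsto_natCast_atTop_atTop

theorem tendsto_logb_logb_atTop :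
    Tendsto (fun n : ℕ => Real.logb 2 (Real.logb 2 n)) atTop atTop :=
  (Real.tendsto_logb_atTop one_lt_two).comp tendsto_logb_two_atTop

theorem eventually_mul_logb_two_le (a : ℝ) :
    ∀ᶠ x : ℝ in atTop, a * Real.logb 2 x ≤ x := by
  have hlog2 : 0 < Real.log 2 := Real.log_pos one_lt_two
  have h : (fun x : ℝ => a * Real.logb 2 x) =o[atTop] (id : ℝ → ℝ) := by
    have h1 := (Real.isLittleO_log_id_atTop).const_mul_left (a / Real.log 2)
    refine h1.congr_left fun x => ?_
    rw [Real.logb]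
    ring
  filter_upwards [h.bound one_pos, eventually_ge_atTop 0] with x hx hx0
  rw [one_mul, id, Real.norm_of_nonneg hx0] at hx
  exact (le_abs_self _).trans hx

/-- The properties of `log n`, `log log n` and `numParts n` that hold for large `n` and suffice for
all later estimates. -/
structure IsLargeVertexCount (n : ℕ) : Prop where
  loglog_ge : 40 ≤ Real.logb 2 (Real.logb 2 n)
  log_ge : 100 * Real.logb 2 (Real.logb 2 n) ≤ Real.logb 2 n
  le : 2 * Real.logb 2 n ≤ n

theorem eventually_isLargeVertexCount : ∀ᶠ n in atTop, IsLargeVertexCount n := by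
  filter_upwards [tendsto_logb_logb_atTop.eventually_ge_atTop 40,
    tendsto_logb_two_atTop.eventually (eventually_mul_logb_two_le 100),
    tendsto_natCast_atTop_atTop.eventually (eventually_mul_logb_two_le 2)] with n h1 h2 h3
  exact ⟨h1, h2, h3⟩

namespace IsLargeVertexCount

variable {n : ℕ}

theorem four_thousand_le (hn : IsLargeVertexCount n) : 4000 ≤ Real.logb 2 n := by
  linarith [hn.loglog_ge, hn.log_ge]

theorem cast_pos (hn : IsLargeVertexCount n) : (0 : ℝ) < n := by
  linarith [hn.four_thousand_le, hn.le]

theorem eq_two_rpow (hn : IsLargeVertexCount n) : (n : ℝ) = 2 ^ Real.logb 2 n :=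
  (Real.rpow_logb two_pos (by norm_num) hn.cast_pos).symm

theorem logb_eq_two_rpow (hn : IsLargeVertexCount n) :
    Real.logb 2 n = 2 ^ Real.logb 2 (Real.logb 2 n) :=
  (Real.rpow_logb two_pos (by norm_num) (by linarith [hn.four_thousand_le])).symm

theorem div_le_numParts :
    Real.logb 2 n / (2 * Real.logb 2 (Real.logb 2 n)) ≤ numParts n :=
  Nat.le_ceil _

theorem numParts_le (hn : IsLargeVertexCount n) :
    (numParts n : ℝ) ≤ Real.logb 2 n / (2 * Real.logb 2 (Real.logb 2 n)) + 1 := by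
  refine (Nat.ceil_lt_add_one (div_nonneg ?_ ?_)).le
  · linarith [hn.four_thousand_le]
  · linarith [hn.loglog_ge]

theorem numParts_le_logb_div (hn : IsLargeVertexCount n) :
    (numParts n : ℝ) ≤ Real.logb 2 n / 80 + 1 := by
  refine hn.numParts_le.trans ?_
  have h1 := hn.loglog_ge
  have h2 := hn.four_thousand_le
  have : Real.logb 2 n / (2 * Real.logb 2 (Real.logb 2 n)) ≤ Real.logb 2 n / 80 :=
    div_le_div_of_nonneg_left (by linarith) (by norm_num) (by linarith)
  linarith

theorem numParts_le_logb (hn : IsLargeVertexCount n) : (numParts n : ℝ) ≤ Real.logb 2 n := by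
  linarith [hn.four_thousand_le, hn.numParts_le_logb_div]

theorem numParts_pos (hn : IsLargeVertexCount n) : 0 < numParts n := by
  refine Nat.ceil_pos.2 (div_pos ?_ ?_)
  · linarith [hn.four_thousand_le]
  · linarith [hn.loglog_ge]

theorem edgeProb_eq (hn : IsLargeVertexCount n) : (edgeProb n : ℝ) = 1 / Real.logb 2 n := by
  have h := hn.four_thousand_le
  rw [edgeProb, Set.projIcc_of_mem zero_le_one
    ⟨by positivity, (div_le_one (by linarith)).2 (by linarith)⟩]

theorem edgeProb_pos (hn : IsLargeVertexCount n) : 0 < (edgeProb n : ℝ) := by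
  have h := hn.four_thousand_le
  rw [hn.edgeProb_eq]
  positivity

theorem div_le_partSize (hn : IsLargeVertexCount n) :
    (n : ℝ) / (2 * numParts n) ≤ (n / numParts n : ℕ) := by
  have hk : (0 : ℝ) < numParts n := Nat.cast_pos.2 hn.numParts_pos
  have h1 : (n : ℝ) / numParts n - 1 ≤ (n / numParts n : ℕ) := by
    rw [← Nat.floor_div_eq_div (K := ℝ)]
    linarith [Nat.lt_floor_add_one ((n : ℝ) / numParts n)]
  -- Since n ≥ 2L ≥ 2k, rounding n/k down loses at most half of it.
  have h2 : 1 ≤ (n : ℝ) / (2 * numParts n) := by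
    rw [le_div_iff₀ (by positivity)]
    linarith [hn.le, hn.numParts_le_logb]
  have h3 : (n : ℝ) / numParts n = 2 * (n / (2 * numParts n)) := by
    field_simp
  linarith

theorem partSize_pos (hn : IsLargeVertexCount n) : 0 < n / numParts n := by
  have hk : (0 : ℝ) < numParts n := Nat.cast_pos.2 hn.numParts_pos
  have h := hn.cast_pos
  exact Nat.cast_pos.1 ((by positivity : (0 : ℝ) < n / (2 * numParts n)).trans_le
    hn.div_le_partSize)

/-- L^(L/(2l)) = 2^(L/2) = n^(1/2); the extra factor L pays for rounding k up. -/
theorem logb_pow_numParts_le (hn : IsLargeVertexCount n) :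
    Real.logb 2 n ^ numParts n ≤ Real.logb 2 n * (n : ℝ) ^ (1 / 2 : ℝ) := by
  have hl := hn.loglog_ge
  have hL := hn.four_thousand_le
  set L := Real.logb 2 n with hLdef
  set l := Real.logb 2 L with hldef
  have hLl : L = 2 ^ l := hn.logb_eq_two_rpow
  calc L ^ numParts n = L ^ (numParts n : ℝ) := (Real.rpow_natCast _ _).symm
    _ ≤ L ^ (L / (2 * l) + 1) :=
        Real.rpow_le_rpow_of_exponent_le (by linarith) hn.numParts_le
    _ = L * L ^ (L / (2 * l)) := by rw [Real.rpow_add_one (by linarith), mul_comm]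
    _ = L * (n : ℝ) ^ (1 / 2 : ℝ) := by
        congr 1
        rw [hn.eq_two_rpow, ← hLdef, ← Real.rpow_mul zero_le_two]
        nth_rewrite 1 [hLl]
        rw [← Real.rpow_mul zero_le_two]
        congr 1
        field_simp

theorem numParts_mul_logb_pow_div_le (hn : IsLargeVertexCount n) :
    numParts n * (1 / (edgeProb n : ℝ)) ^ numParts n / (n / numParts n : ℕ) ≤
      2 * (Real.logb 2 n ^ 3 / (n : ℝ) ^ (1 / 2 : ℝ)) := by
  have hL := hn.four_thousand_le
  have hn0 := hn.cast_pos
  have hm : (0 : ℝ) < (n / numParts n : ℕ) := Nat.cast_pos.2 hn.partSize_pos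
  have hk : (0 : ℝ) < numParts n := Nat.cast_pos.2 hn.numParts_pos
  rw [hn.edgeProb_eq, one_div_one_div]
  have hsq : (n : ℝ) = (n : ℝ) ^ (1 / 2 : ℝ) * (n : ℝ) ^ (1 / 2 : ℝ) := by
    rw [← Real.rpow_add hn0]; norm_num
  have hr : 0 < (n : ℝ) ^ (1 / 2 : ℝ) := by positivity
  calc numParts n * Real.logb 2 n ^ numParts n / (n / numParts n : ℕ)
      ≤ numParts n * (Real.logb 2 n * (n : ℝ) ^ (1 / 2 : ℝ)) / (n / (2 * numParts n)) := by
        gcongr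
        · exact hn.logb_pow_numParts_le
        · exact hn.div_le_partSize
    _ = 2 * (numParts n ^ 2 * Real.logb 2 n * ((n : ℝ) ^ (1 / 2 : ℝ) / n)) := by
        field_simp
    _ ≤ 2 * (Real.logb 2 n ^ 2 * Real.logb 2 n * ((n : ℝ) ^ (1 / 2 : ℝ) / n)) := by
        have := hn.numParts_le_logb
        gcongr
    _ = 2 * (Real.logb 2 n ^ 3 / (n : ℝ) ^ (1 / 2 : ℝ)) := by
        have hdiv : (n : ℝ) ^ (1 / 2 : ℝ) / n = 1 / (n : ℝ) ^ (1 / 2 : ℝ) := by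
          rw [div_eq_div_iff hn0.ne' hr.ne', one_mul, ← hsq]
        rw [hdiv]
        ring

/-- The base-2 logarithm of the inequality behind `rpow_mul_le`. Beyond the quadratic part, the cost
is 1 + 4k + (3/2)lk, about 3L/4, which is below 9L/10. -/
theorem exponent_le (hn : IsLargeVertexCount n) :
    Real.logb 2 n * (3 * Real.logb 2 n / (8 * Real.logb 2 (Real.logb 2 n))) +
      (1 + (1 + 2 * Real.logb 2 (Real.logb 2 n)) * numParts n +
        Real.logb 2 (Real.logb 2 n) * (numParts n * (numParts n - 1) / 2)) ≤
      Real.logb 2 n * (9 / 10) + (Real.logb 2 n - 3) * numParts n := by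
  have hl := hn.loglog_ge
  have hL := hn.four_thousand_le
  have hlL := hn.log_ge
  have hk1 := div_le_numParts (n := n)
  have hk2 := hn.numParts_le
  have hk3 := hn.numParts_le_logb_div
  set L := Real.logb 2 n
  set l := Real.logb 2 L
  set k : ℝ := (numParts n : ℝ)
  set x := L / (2 * l) with hx
  have hxl : l * x = L / 2 := by rw [hx]; field_simp
  have h1 : L * (3 * L / (8 * l)) = 3 / 4 * (L * x) := by rw [hx]; field_simp; ring
  have hlk : l * k ≤ L / 2 + l := by
    have := mul_le_mul_of_nonneg_left hk2 (by linarith : 0 ≤ l)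
    rw [mul_add, hxl] at this
    linarith
  -- The quadratic t ↦ Lt - lt²/2 has value 3Lx/4 at x and increases up to its vertex L/l = 2x, so
  -- rounding x up to k does no harm.
  have hquad : 3 / 4 * (L * x) ≤ L * k - l * k ^ 2 / 2 := by
    have h0 : 0 ≤ (k - x) * (L - l * (k - x)) := by
      refine mul_nonneg (by linarith) ?_
      have : l * (k - x) ≤ l * 1 := mul_le_mul_of_nonneg_left (by linarith) (by linarith)
      linarith
    have h2 : (k - x) * (L - l * (k - x)) =
        L * k - L * x - l * k ^ 2 + 2 * k * (l * x) - x * (l * x) := by ring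
    rw [h2, hxl] at h0
    linarith
  rw [h1]
  linarith

/-- From k! ≥ (k/e)^k ≥ (k/4)^k and m ≥ n/(2k), the powers of k cancel. -/
theorem div_eight_pow_le (hn : IsLargeVertexCount n) :
    ((n : ℝ) / 8) ^ numParts n ≤
      (numParts n).factorial * ((n / numParts n : ℕ) : ℝ) ^ numParts n := by
  have hk : (0 : ℝ) < numParts n := Nat.cast_pos.2 hn.numParts_pos
  have hn0 := hn.cast_pos
  have hfac : ((numParts n : ℝ) / 4) ^ numParts n ≤ (numParts n).factorial := by
    have h := Real.pow_div_factorial_le_exp _ hk.le (numParts n)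
    rw [div_le_iff₀ (by positivity), ← mul_one (numParts n : ℝ), Real.exp_nat_mul, mul_one] at h
    rw [div_pow, div_le_iff₀ (by positivity), mul_comm]
    refine h.trans ?_
    gcongr
    linarith [Real.exp_one_lt_d9]
  calc ((n : ℝ) / 8) ^ numParts n =
        ((numParts n : ℝ) / 4) ^ numParts n * (n / (2 * numParts n)) ^ numParts n := by
        rw [← mul_pow]
        congr 1
        field_simp
        norm_num
    _ ≤ _ := by
        gcongr
        exact hn.div_le_partSize

/-- The expected number of transversal cliques, divided by the number of those in a cluster of size
`2 log² n`, is almost `n ^ (3 log n / (8 log log n))`. -/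
theorem rpow_mul_le (hn : IsLargeVertexCount n) :
    (n : ℝ) ^ (3 * Real.logb 2 n / (8 * Real.logb 2 (Real.logb 2 n))) *
      (2 * ((2 * Real.logb 2 n ^ 2) ^ numParts n / (numParts n).factorial)) ≤
      (n : ℝ) ^ (9 / 10 : ℝ) * (((n / numParts n : ℕ) : ℝ) ^ numParts n *
        (edgeProb n : ℝ) ^ (numParts n).choose 2) := by
  have hL := hn.four_thousand_le
  have hn0 := hn.cast_pos
  have hexp := hn.exponent_le
  have hdiv := hn.div_eight_pow_le
  have hnL := hn.eq_two_rpow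
  have hLl := hn.logb_eq_two_rpow
  rw [hn.edgeProb_eq]
  set L := Real.logb 2 n
  set l := Real.logb 2 L
  set k := numParts n
  have hfac : (0 : ℝ) < k.factorial := by positivity
  have hA : (n : ℝ) ^ (3 * L / (8 * l)) = 2 ^ (L * (3 * L / (8 * l))) := by
    rw [hnL, ← Real.rpow_mul zero_le_two]
  have hB : (2 * L ^ 2) ^ k = 2 ^ ((1 + 2 * l) * k) := by
    rw [Real.rpow_mul zero_le_two, Real.rpow_natCast, Real.rpow_add two_pos, Real.rpow_one,
      mul_comm 2 l, Real.rpow_mul zero_le_two, ← hLl]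
    norm_num
  have hC : L ^ k.choose 2 = 2 ^ (l * (k * (k - 1) / 2)) := by
    rw [← Nat.cast_choose_two, Real.rpow_mul zero_le_two, Real.rpow_natCast, ← hLl]
  have hD : ((n : ℝ) / 8) ^ k = 2 ^ ((L - 3) * k) := by
    rw [Real.rpow_mul zero_le_two, Real.rpow_natCast, Real.rpow_sub two_pos, ← hnL]
    norm_num
  have hE : (n : ℝ) ^ (9 / 10 : ℝ) = 2 ^ (L * (9 / 10)) := by
    rw [hnL, ← Real.rpow_mul zero_le_two]
  have hmain : (n : ℝ) ^ (3 * L / (8 * l)) * (2 * (2 * L ^ 2) ^ k * L ^ k.choose 2) ≤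
      (n : ℝ) ^ (9 / 10 : ℝ) * (k.factorial * ((n / k : ℕ) : ℝ) ^ k) := by
    refine le_trans ?_ (mul_le_mul_of_nonneg_left hdiv (by positivity))
    rw [hA, hB, hC, hD, hE, ← Real.rpow_add two_pos]
    -- The factor 2 comes from the threshold at half the expectation; it is the summand 1 in
    -- `exponent_le`.
    nth_rewrite 2 [← Real.rpow_one 2]
    rw [← Real.rpow_add two_pos, ← Real.rpow_add two_pos, ← Real.rpow_add two_pos]
    exact Real.rpow_le_rpow_of_exponent_le one_le_two hexp
  have hLc : 0 < L ^ k.choose 2 := by positivity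
  rw [one_div, inv_pow]
  calc _ = (n : ℝ) ^ (3 * L / (8 * l)) * (2 * (2 * L ^ 2) ^ k * L ^ k.choose 2) /
        (k.factorial * L ^ k.choose 2) := by field_simp
    _ ≤ (n : ℝ) ^ (9 / 10 : ℝ) * (k.factorial * ((n / k : ℕ) : ℝ) ^ k) /
        (k.factorial * L ^ k.choose 2) := by gcongr
    _ = _ := by field_simp

theorem real_exists_large_dense_le (hn : IsLargeVertexCount n) :
    (randomPartite n).real {G | ∃ C : Finset (Fin n), 2 * Real.logb 2 n ^ 2 < C.card ∧
      6 / Real.logb 2 n ≤ graphDensity (G.induce (C : Set (Fin n)))} ≤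
      Real.exp (1 / (n : ℝ) ^ 2) - 1 := by
  have hL := hn.four_thousand_le
  have hn0 := hn.cast_pos
  have hnL := hn.eq_two_rpow
  have hp := hn.edgeProb_eq
  set L := Real.logb 2 n
  set B : Finset (Finset (Fin n)) := Finset.univ.filter fun C => 2 * L ^ 2 < C.card
  have hsub : {G : SimpleGraph (Fin n) | ∃ C : Finset (Fin n), 2 * L ^ 2 < C.card ∧
      6 / L ≤ graphDensity (G.induce (C : Set (Fin n)))} ⊆
      ⋃ C ∈ B, {G | 6 / L ≤ graphDensity (G.induce (C : Set (Fin n)))} := by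
    rintro G ⟨C, hC, hG⟩
    simp only [Set.mem_iUnion]
    exact ⟨C, Finset.mem_filter.2 ⟨Finset.mem_univ C, hC⟩, hG⟩
  have hone : ∀ C ∈ B, (randomPartite n).real
      {G | 6 / L ≤ graphDensity (G.induce (C : Set (Fin n)))} ≤ (1 / (n : ℝ) ^ 3) ^ C.card := by
    intro C hC
    have hC : 2 * L ^ 2 < C.card := (Finset.mem_filter.1 hC).2
    -- Hence (6/L)(|C| choose 2) ≥ 3|C|L, and 2^(-3|C|L) = n^(-3|C|).
    have hC1 : L ^ 2 ≤ (C.card : ℝ) - 1 := by nlinarith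
    have hC2 : (2 : ℝ) ≤ C.card := by nlinarith
    refine (randomSubgraph_real_dense_le _ _ C (by exact_mod_cast hC2) (x := 3 * C.card * L)
      (by rw [hp]; exact (mul_one_div _ _).le) ?_).trans_eq ?_
    · rw [Nat.cast_choose_two, div_mul_eq_mul_div, le_div_iff₀ (by linarith)]
      have := mul_le_mul_of_nonneg_left hC1 (by linarith : 0 ≤ 3 * (C.card : ℝ))
      linarith
    · rw [hnL, one_div, one_div, Real.inv_rpow zero_le_two, inv_pow, ← pow_mul,
        ← Real.rpow_natCast (2 ^ L), ← Real.rpow_mul zero_le_two]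
      congr 2
      push_cast
      ring
  calc _ ≤ (randomPartite n).real
        (⋃ C ∈ B, {G | 6 / L ≤ graphDensity (G.induce (C : Set (Fin n)))}) :=
        measureReal_mono hsub (measure_ne_top (randomSubgraph _ _) _)
    _ ≤ ∑ C ∈ B, (1 / (n : ℝ) ^ 3) ^ C.card :=
        (measureReal_biUnion_finset_le _ _).trans (Finset.sum_le_sum hone)
    -- Summing over all nonempty sets gives a binomial expansion; the missing empty set is the
    -- subtracted 1.
    _ ≤ ∑ C ∈ (Finset.univ : Finset (Finset (Fin n))).erase ∅, (1 / (n : ℝ) ^ 3) ^ C.card := by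
        refine Finset.sum_le_sum_of_subset_of_nonneg ?_ fun _ _ _ => by positivity
        intro C hC
        refine Finset.mem_erase.2 ⟨?_, Finset.mem_univ C⟩
        rintro rfl
        have := (Finset.mem_filter.1 hC).2
        rw [Finset.card_empty, Nat.cast_zero] at this
        nlinarith
    _ = (1 / (n : ℝ) ^ 3 + 1) ^ n - 1 := by
        rw [Finset.sum_erase_eq_sub (Finset.mem_univ _), Finset.card_empty, pow_zero]
        have h := Fintype.sum_pow_mul_eq_add_pow (Fin n) (1 / (n : ℝ) ^ 3) 1
        simp only [one_pow, mul_one, Fintype.card_fin] at h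
        rw [h]
    _ ≤ Real.exp (1 / (n : ℝ) ^ 3) ^ n - 1 := by
        gcongr
        exact Real.add_one_le_exp _
    _ = Real.exp (1 / (n : ℝ) ^ 2) - 1 := by
        rw [← Real.exp_nat_mul]
        congr 2
        field_simp

end IsLargeVertexCount

end Asymptotics

/-! ### The family of graphs and the final bound. -/

/-- The graphs with many transversal cliques and no large set of density at least `6 / log n`. -/
def cliqueRichGraphs (n : ℕ) : Set (SimpleGraph (Fin n)) :=
  {G | IsLargeVertexCount n ∧ G ≤ SimpleGraph.turanGraph n (numParts n) ∧
    ((n / numParts n : ℕ) : ℝ) ^ numParts n * (edgeProb n : ℝ) ^ (numParts n).choose 2 / 2 ≤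
      numTransversalCliques (Nat.mul_div_le n (numParts n)) G ∧
    ∀ C : Finset (Fin n), 2 * Real.logb 2 n ^ 2 < C.card →
      graphDensity (G.induce (C : Set (Fin n))) < 6 / Real.logb 2 n}

theorem IsLargeVertexCount.real_compl_cliqueRichGraphs_le {n : ℕ} (hn : IsLargeVertexCount n) :
    (randomPartite n).real (cliqueRichGraphs n)ᶜ ≤
      4 * (Real.exp (2 * (Real.logb 2 n ^ 3 / (n : ℝ) ^ (1 / 2 : ℝ))) - 1) +
        (Real.exp (1 / (n : ℝ) ^ 2) - 1) := by
  have : IsProbabilityMeasure (randomPartite n) := randomSubgraph_isProbabilityMeasure _ _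
  set D : Set (SimpleGraph (Fin n)) := {G | ¬ G ≤ SimpleGraph.turanGraph n (numParts n)}
  set E : Set (SimpleGraph (Fin n)) :=
    {G | (numTransversalCliques (Nat.mul_div_le n (numParts n)) G : ℝ) <
      ((n / numParts n : ℕ) : ℝ) ^ numParts n * (edgeProb n : ℝ) ^ (numParts n).choose 2 / 2}
  set F : Set (SimpleGraph (Fin n)) := {G | ∃ C : Finset (Fin n), 2 * Real.logb 2 n ^ 2 < C.card ∧
      6 / Real.logb 2 n ≤ graphDensity (G.induce (C : Set (Fin n)))}
  have hsub : (cliqueRichGraphs n)ᶜ ⊆ D ∪ (E ∪ F) := by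
    intro G hG
    by_contra hcon
    simp only [Set.mem_union, not_or] at hcon
    obtain ⟨hD, hE, hF⟩ := hcon
    refine hG ⟨hn, not_not.1 hD, not_lt.1 hE, fun C hC => ?_⟩
    by_contra hlt
    exact hF ⟨C, hC, not_lt.1 hlt⟩
  have hD : (randomPartite n).real D = 0 := by
    rw [measureReal_def, randomPartite, randomSubgraph_not_le, ENNReal.toReal_zero]
  have hE : (randomPartite n).real E ≤
      4 * (Real.exp (2 * (Real.logb 2 n ^ 3 / (n : ℝ) ^ (1 / 2 : ℝ))) - 1) := by
    refine (randomSubgraph_real_numTransversalCliques_lt_le _ hn.partSize_pos _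
      hn.edgeProb_pos).trans ?_
    gcongr
    exact hn.numParts_mul_logb_pow_div_le
  calc (randomPartite n).real (cliqueRichGraphs n)ᶜ
      ≤ (randomPartite n).real (D ∪ (E ∪ F)) := measureReal_mono hsub
    _ ≤ (randomPartite n).real D + ((randomPartite n).real E + (randomPartite n).real F) :=
        (measureReal_union_le _ _).trans (by gcongr; exact measureReal_union_le _ _)
    _ ≤ _ := by
        rw [hD, zero_add]
        exact add_le_add hE hn.real_exists_large_dense_le

theorem tendsto_randomPartite_cliqueRichGraphs :
    Tendsto (fun n => randomPartite n (cliqueRichGraphs n)) atTop (𝓝 1) := by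
  have hlog2 : Real.log 2 ≠ 0 := (Real.log_pos one_lt_two).ne'
  have hpolylog : Tendsto (fun n : ℕ => Real.logb 2 n ^ 3 / (n : ℝ) ^ (1 / 2 : ℝ)) atTop (𝓝 0) := by
    have h := ((isLittleO_log_rpow_rpow_atTop (3 : ℝ) (by norm_num : (0 : ℝ) < 1 / 2)
      ).tendsto_div_nhds_zero.comp tendsto_natCast_atTop_atTop).const_mul ((Real.log 2 ^ 3)⁻¹)
    rw [mul_zero] at h
    refine h.congr fun n => ?_
    have h3 : Real.log n ^ (3 : ℝ) = Real.log n ^ 3 := by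
      rw [← Real.rpow_natCast]; norm_num
    simp only [Function.comp_apply]
    rw [h3, Real.logb, div_pow]
    ring
  have hsq : Tendsto (fun n : ℕ => 1 / (n : ℝ) ^ 2) atTop (𝓝 0) := by
    simpa using tendsto_inv_atTop_nhds_zero_nat (𝕜 := ℝ) |>.pow 2
  have hexp : ∀ {u : ℕ → ℝ}, Tendsto u atTop (𝓝 0) →
      Tendsto (fun n => Real.exp (u n) - 1) atTop (𝓝 0) := by
    intro u hu
    simpa using ((Real.continuous_exp.tendsto 0).comp hu).sub_const 1
  have hbound : Tendsto (fun n : ℕ =>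
      4 * (Real.exp (2 * (Real.logb 2 n ^ 3 / (n : ℝ) ^ (1 / 2 : ℝ))) - 1) +
        (Real.exp (1 / (n : ℝ) ^ 2) - 1)) atTop (𝓝 0) := by
    have h2 := hpolylog.const_mul 2
    rw [mul_zero] at h2
    simpa using ((hexp h2).const_mul 4).add (hexp hsq)
  have hprob : ∀ n, IsProbabilityMeasure (randomPartite n) := fun n =>
    randomSubgraph_isProbabilityMeasure _ _
  have hcompl : Tendsto (fun n => (randomPartite n).real (cliqueRichGraphs n)ᶜ) atTop (𝓝 0) :=
    tendsto_of_tendsto_of_tendsto_of_le_of_le' tendsto_const_nhds hbound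
      (Eventually.of_forall fun n => measureReal_nonneg)
      (eventually_isLargeVertexCount.mono fun n hn => hn.real_compl_cliqueRichGraphs_le)
  have hreal : Tendsto (fun n => (randomPartite n).real (cliqueRichGraphs n)) atTop (𝓝 1) := by
    have h := hcompl.const_sub 1
    rw [sub_zero] at h
    refine h.congr fun n => ?_
    have := SimpleGraph.discreteMeasurableSpace (V := Fin n)
    rw [probReal_compl_eq_one_sub MeasurableSet.of_discrete, sub_sub_cancel]
  have h := ENNReal.tendsto_ofReal hreal
  rw [ENNReal.ofReal_one] at h
  exact h.congr fun n => ofReal_measureReal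

theorem rpow_le_of_mem_cliqueRichGraphs {n : ℕ} {G : SimpleGraph (Fin n)}
    (hG : G ∈ cliqueRichGraphs n) {ρ : ℝ} (hρ : 6 / Real.logb 2 n ≤ ρ)
    {S : Finset (Finset (Fin n))} (hS : IsDenseAggregator G ρ S) :
    (n : ℝ) ^ (3 * Real.logb 2 n / (8 * Real.logb 2 (Real.logb 2 n))) ≤
      (n : ℝ) ^ (9 / 10 : ℝ) * S.card := by
  -- Membership includes `IsLargeVertexCount n`, so the family is empty at small n and the bound
  -- holds there vacuously.
  obtain ⟨hn, -, hmany, hsparse⟩ := hG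
  have hsize : ∀ C ∈ S, (C.card : ℝ) ≤ 2 * Real.logb 2 n ^ 2 := by
    intro C hC
    by_contra hlt
    exact absurd (hsparse C (not_le.1 hlt)) (not_lt.2 (hρ.trans (hS.density_ge C hC)))
  have hcount := hmany.trans (numTransversalCliques_le _ hn.numParts_pos hS hsize)
  have hL := hn.four_thousand_le
  have hmain := hn.rpow_mul_le
  set c := (2 * Real.logb 2 n ^ 2) ^ numParts n / (numParts n).factorial
  have hc : 0 < c := by positivity
  refine le_of_mul_le_mul_right (hmain.trans ?_) (by positivity : 0 < 2 * c)
  rw [mul_assoc]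
  exact mul_le_mul_of_nonneg_left (by linarith) (by positivity)

theorem theorem4p1 :
    ∃ (c : ℝ) (g : ℕ → ℝ) (𝒢 : ∀ n : ℕ, Set (SimpleGraph (Fin n))),
      0 < c ∧
      g =o[atTop] (fun n : ℕ => (n : ℝ)) ∧
      Tendsto (fun n : ℕ => randomPartite n (𝒢 n)) atTop (𝓝 1) ∧
      ∀ n : ℕ, ∀ G ∈ 𝒢 n,
        G ≤ SimpleGraph.turanGraph n (numParts n) ∧
        ∀ ρ : ℝ, 0 < ρ → ρ ≤ 1 → c / Real.logb 2 n ≤ ρ →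
          ∀ S : Finset (Finset (Fin n)), IsDenseAggregator G ρ S →
            (n : ℝ) ^ (3 * Real.logb 2 n / (8 * Real.logb 2 (Real.logb 2 n))) ≤
              g n * (S.card : ℝ) := by
  refine ⟨6, fun n => (n : ℝ) ^ (9 / 10 : ℝ), cliqueRichGraphs, by norm_num, ?_,
    tendsto_randomPartite_cliqueRichGraphs, fun n G hG => ⟨hG.2.1, fun ρ _ _ hρ S hS =>
      rpow_le_of_mem_cliqueRichGraphs hG hρ hS⟩⟩
  have h : Tendsto (fun n : ℕ => (n : ℝ) ^ (-(1 / 10) : ℝ)) atTop (𝓝 0) :=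
    (tendsto_rpow_neg_atTop (by norm_num)).comp tendsto_natCast_atTop_atTop
  refine (isLittleO_iff_tendsto' ?_).2 (h.congr' ?_)
  · filter_upwards [eventually_gt_atTop 0] with n hn h0
    exact absurd h0 (Nat.cast_ne_zero.2 hn.ne')
  · filter_upwards [eventually_gt_atTop 0] with n hn
    rw [← Real.rpow_sub_one (Nat.cast_ne_zero.2 hn.ne')]
    norm_num
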